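/- All graphs are finite and simple. The line graph $L(H)$ of a graph $H$ has the edges of $H$ as its vertices, two distinct edges being adjacent in $L(H)$ when they share an endpoint; $L^2(H)=L(L(H))$. Let $K_4-e$ be the graph on $\{0,1,2,3\}$ with edges $01,02,12,13,23$, and let - $G_1=K_{1,3}$; - $G_2$ be $K_4-e$ with a new vertex $4$ joined to $0$ and $3$; - $G_3=K_5-e$ be the complete graph on five vertices with one edge removed; - $G_4$ be $K_4-e$ with new vertices $4,5$ and new edges $04,35$; - $G_5$ be $G_4$ with the additional edges $14,24$; - $G_6$ be $G_4$ with the additional edges $14,24,15,25$ (two copies of $K_4$ sharing exactly an edge); - $G_7$ be $G_4$ with the additional edge $45$; - $G_8$ be $G_4$ with the additional edges $24,15$ (the square of a path on six vertices); - $G_9$ be $G_4$ with the additional edges $45,14,15$ (the wheel with hub $1$ and a rim of length five); - $H_1$ be $G_8$ with a new vertex joined to $0,4$; - $H_2$ be $G_8$ with a new vertex joined to $0,1,5$; - $H_3$ be $G_8$ with two new vertices, adjacent to each other, one joined to $0,4$ and the other to $0,1,5$; - $F_1=L(G_4)$ and $F_2=L(G_2)$. **Theorem.** Let $G$ be a connected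 graph that is not isomorphic to any of $K_3,G_8,G_9,H_1,H_2,H_3$. Suppose that (a) every triangle of $G$ is contained in an induced subgraph of $G$ isomorphic to $K_4-e$, and (b) $G$ contains none of $G_1,\dots,G_7,F_1,F_2$ as an induced subgraph. Then $G\cong L^2(H)$ for some connected graph $H$. -/

import Mathlib

namespace ForbiddenGraphs

/-- The simple graph on the vertices `0, …, n - 1` whose edges are the pairs in the list `l`. -/
def ofEdges (n : ℕ) (l : List (Fin n × Fin n)) : SimpleGraph (Fin n) :=
  SimpleGraph.fromRel fun a b => (a, b) ∈ l

instance (n : ℕ) (l : List (Fin n × Fin n)) : DecidableRel (ofEdges n l).Adj :=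
  fun a b => decidable_of_iff (a ≠ b ∧ ((a, b) ∈ l ∨ (b, a) ∈ l)) Iff.rfl

/-- `K₄ - e`: the complete graph on four vertices with the edge `03` removed. -/
abbrev K4e : SimpleGraph (Fin 4) :=
  ofEdges 4 [(0, 1), (0, 2), (1, 2), (1, 3), (2, 3)]

/-- The claw `K_{1,3}`. -/
abbrev G1 : SimpleGraph (Fin 4) :=
  ofEdges 4 [(0, 1), (0, 2), (0, 3)]

/-- `K₄ - e` and a vertex joined to the two vertices of degree 2. -/
abbrev G2 : SimpleGraph (Fin 5) :=
  ofEdges 5 [(0, 1), (0, 2), (1, 2), (1, 3), (2, 3), (0, 4), (3, 4)]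

/-- `K₅ - e`: the complete graph on five vertices with the edge `03` removed. -/
abbrev G3 : SimpleGraph (Fin 5) :=
  ofEdges 5 [(0, 1), (0, 2), (1, 2), (1, 3), (2, 3), (0, 4), (1, 4), (2, 4), (3, 4)]

/-- `K₄ - e` with a pendant edge at each of the two vertices of degree 2. -/
abbrev G4 : SimpleGraph (Fin 6) :=
  ofEdges 6 [(0, 1), (0, 2), (1, 2), (1, 3), (2, 3), (0, 4), (3, 5)]

/-- `K₄` and a triangle with exactly an edge in common, and a pendant edge at the vertex of the
triangle outside `K₄`. -/
abbrev G5 : SimpleGraph (Fin 6) :=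
  ofEdges 6 [(0, 1), (0, 2), (1, 2), (1, 3), (2, 3), (0, 4), (3, 5), (1, 4), (2, 4)]

/-- Two copies of `K₄` with exactly an edge in common. -/
abbrev G6 : SimpleGraph (Fin 6) :=
  ofEdges 6 [(0, 1), (0, 2), (1, 2), (1, 3), (2, 3), (0, 4), (3, 5), (1, 4), (2, 4),
    (1, 5), (2, 5)]

/-- `K₄ - e` whose two vertices of degree 2 are joined by a further path with three edges. -/
abbrev G7 : SimpleGraph (Fin 6) :=
  ofEdges 6 [(0, 1), (0, 2), (1, 2), (1, 3), (2, 3), (0, 4), (3, 5), (4, 5)]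

/-- The square of the path `4, 0, 2, 1, 3, 5`. -/
abbrev G8 : SimpleGraph (Fin 6) :=
  ofEdges 6 [(0, 1), (0, 2), (1, 2), (1, 3), (2, 3), (0, 4), (3, 5), (2, 4), (1, 5)]

/-- The wheel with hub `1` and rim the 5-cycle `0, 2, 3, 5, 4`. -/
abbrev G9 : SimpleGraph (Fin 6) :=
  ofEdges 6 [(0, 1), (0, 2), (1, 2), (1, 3), (2, 3), (0, 4), (3, 5), (4, 5), (1, 4), (1, 5)]

/-- `G₈` and a vertex joined to `0, 4`. -/
abbrev H1 : SimpleGraph (Fin 7) :=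
  ofEdges 7 [(0, 1), (0, 2), (1, 2), (1, 3), (2, 3), (0, 4), (3, 5), (2, 4), (1, 5),
    (0, 6), (4, 6)]

/-- `G₈` and a vertex joined to `0, 1, 5`. -/
abbrev H2 : SimpleGraph (Fin 7) :=
  ofEdges 7 [(0, 1), (0, 2), (1, 2), (1, 3), (2, 3), (0, 4), (3, 5), (2, 4), (1, 5),
    (0, 6), (1, 6), (5, 6)]

/-- `G₈` with two further adjacent vertices, one joined to `0, 4` and the other to `0, 1, 5`. -/
abbrev H3 : SimpleGraph (Fin 8) :=
  ofEdges 8 [(0, 1), (0, 2), (1, 2), (1, 3), (2, 3), (0, 4), (3, 5), (2, 4), (1, 5),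
    (0, 6), (4, 6), (0, 7), (1, 7), (5, 7), (6, 7)]

/-- `F₁ = L(G₄)`. -/
abbrev F1 : SimpleGraph G4.edgeSet := G4.lineGraph

/-- `F₂ = L(G₂)`. -/
abbrev F2 : SimpleGraph G2.edgeSet := G2.lineGraph

end ForbiddenGraphs

namespace ForbiddenGraphs

open SimpleGraph

variable {V : Type*} {G : SimpleGraph V}

/-! The graphs `G1`, …, `G9` are Beineke's nine obstructions to being a line graph, so the idea is
to apply Beineke's theorem twice: to `G`, giving `G ≅ L(K)`, and then to the root `K`.

For `G`, only `G8` and `G9` are not excluded outright. A case analysis of how outside vertices can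
attach to a copy of one of them (`nonempty_iso_of_G8`, `nonempty_iso_of_G9`) shows that a connected
graph containing it is one of the listed exceptions.

For `K`, a claw gives a triangle in `L(K)`, and the fourth vertex of a `K4e` around that triangle
would be an edge joining two leaves of the claw (`not_G1_of_lineGraph`). Each other obstruction
contains `G2` or `G4` as a spanning subgraph, so its presence in `K` would put `F2` or `F1` into
`L(K)` as an induced subgraph.

Beineke's theorem itself (`exists_root`) rests on odd triangles. The obstructions forbid two odd
triangles on a common edge with nonadjacent apexes. If two even triangles never form such a diamond
either, the odd cliques partition the edges with at most two through each vertex, and they serve as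
the vertices of a root (Krausz). If two even triangles do, `G` is an induced subgraph of the
octahedron `L(K₄)`. -/

/-- A tuple of distinct vertices with the adjacencies of `S` is an induced copy of `S`. -/
def embeddingOfTuple {n : ℕ} {S : SimpleGraph (Fin n)} (p : Fin n → V)
    (hp : ∀ i j, i < j → (S.Adj i j ∨ p i ≠ p j) ∧ (G.Adj (p i) (p j) ↔ S.Adj i j)) : S ↪g G where
  toFun := p
  inj' i j hij := by
    rcases lt_trichotomy i j with h | h | h
    · exact absurd hij ((hp i j h).1.elim (fun h' => ((hp i j h).2.2 h').ne) id)
    · exact h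
    · exact absurd hij.symm ((hp j i h).1.elim (fun h' => ((hp j i h).2.2 h').ne) id)
  map_rel_iff' {i j} := by
    rcases lt_trichotomy i j with h | h | h
    · exact (hp i j h).2
    · subst h; simp
    · rw [S.adj_comm, G.adj_comm]; exact (hp j i h).2

/-! ### Forbidden induced subgraphs as adjacency patterns -/

lemma not_G1 (h : ¬ G1 ⊴ G) (v0 v1 v2 v3 : V)
    (h01 : G.Adj v0 v1) (h02 : G.Adj v0 v2) (h03 : G.Adj v0 v3) (h12 : ¬ G.Adj v1 v2)
    (h13 : ¬ G.Adj v1 v3) (h23 : ¬ G.Adj v2 v3) (n12 : v1 ≠ v2) (n13 : v1 ≠ v3) (n23 : v2 ≠ v3) :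
    False := by
  refine h ⟨embeddingOfTuple ![v0, v1, v2, v3] ?_⟩
  simp [Fin.forall_fin_succ, ofEdges, *]

lemma not_G2 (h : ¬ G2 ⊴ G) (v0 v1 v2 v3 v4 : V)
    (h01 : G.Adj v0 v1) (h02 : G.Adj v0 v2) (h03 : ¬ G.Adj v0 v3) (h04 : G.Adj v0 v4)
    (h12 : G.Adj v1 v2) (h13 : G.Adj v1 v3) (h14 : ¬ G.Adj v1 v4) (h23 : G.Adj v2 v3)
    (h24 : ¬ G.Adj v2 v4) (h34 : G.Adj v3 v4) (n03 : v0 ≠ v3) (n14 : v1 ≠ v4) (n24 : v2 ≠ v4) :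
    False := by
  refine h ⟨embeddingOfTuple ![v0, v1, v2, v3, v4] ?_⟩
  simp [Fin.forall_fin_succ, ofEdges, *]

lemma not_G3 (h : ¬ G3 ⊴ G) (v0 v1 v2 v3 v4 : V)
    (h01 : G.Adj v0 v1) (h02 : G.Adj v0 v2) (h03 : ¬ G.Adj v0 v3) (h04 : G.Adj v0 v4)
    (h12 : G.Adj v1 v2) (h13 : G.Adj v1 v3) (h14 : G.Adj v1 v4) (h23 : G.Adj v2 v3)
    (h24 : G.Adj v2 v4) (h34 : G.Adj v3 v4) (n03 : v0 ≠ v3) :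
    False := by
  refine h ⟨embeddingOfTuple ![v0, v1, v2, v3, v4] ?_⟩
  simp [Fin.forall_fin_succ, ofEdges, *]

lemma not_G4 (h : ¬ G4 ⊴ G) (v0 v1 v2 v3 v4 v5 : V)
    (h01 : G.Adj v0 v1) (h02 : G.Adj v0 v2) (h03 : ¬ G.Adj v0 v3) (h04 : G.Adj v0 v4)
    (h05 : ¬ G.Adj v0 v5) (h12 : G.Adj v1 v2) (h13 : G.Adj v1 v3) (h14 : ¬ G.Adj v1 v4)
    (h15 : ¬ G.Adj v1 v5) (h23 : G.Adj v2 v3) (h24 : ¬ G.Adj v2 v4) (h25 : ¬ G.Adj v2 v5)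
    (h34 : ¬ G.Adj v3 v4) (h35 : G.Adj v3 v5) (h45 : ¬ G.Adj v4 v5) (n03 : v0 ≠ v3)
    (n05 : v0 ≠ v5) (n14 : v1 ≠ v4) (n15 : v1 ≠ v5) (n24 : v2 ≠ v4) (n25 : v2 ≠ v5)
    (n34 : v3 ≠ v4) (n45 : v4 ≠ v5) :
    False := by
  refine h ⟨embeddingOfTuple ![v0, v1, v2, v3, v4, v5] ?_⟩
  simp [Fin.forall_fin_succ, ofEdges, *]

lemma not_G5 (h : ¬ G5 ⊴ G) (v0 v1 v2 v3 v4 v5 : V)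
    (h01 : G.Adj v0 v1) (h02 : G.Adj v0 v2) (h03 : ¬ G.Adj v0 v3) (h04 : G.Adj v0 v4)
    (h05 : ¬ G.Adj v0 v5) (h12 : G.Adj v1 v2) (h13 : G.Adj v1 v3) (h14 : G.Adj v1 v4)
    (h15 : ¬ G.Adj v1 v5) (h23 : G.Adj v2 v3) (h24 : G.Adj v2 v4) (h25 : ¬ G.Adj v2 v5)
    (h34 : ¬ G.Adj v3 v4) (h35 : G.Adj v3 v5) (h45 : ¬ G.Adj v4 v5) (n03 : v0 ≠ v3)
    (n05 : v0 ≠ v5) (n15 : v1 ≠ v5) (n25 : v2 ≠ v5) (n34 : v3 ≠ v4) (n45 : v4 ≠ v5) :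
    False := by
  refine h ⟨embeddingOfTuple ![v0, v1, v2, v3, v4, v5] ?_⟩
  simp [Fin.forall_fin_succ, ofEdges, *]

lemma not_G6 (h : ¬ G6 ⊴ G) (v0 v1 v2 v3 v4 v5 : V)
    (h01 : G.Adj v0 v1) (h02 : G.Adj v0 v2) (h03 : ¬ G.Adj v0 v3) (h04 : G.Adj v0 v4)
    (h05 : ¬ G.Adj v0 v5) (h12 : G.Adj v1 v2) (h13 : G.Adj v1 v3) (h14 : G.Adj v1 v4)
    (h15 : G.Adj v1 v5) (h23 : G.Adj v2 v3) (h24 : G.Adj v2 v4) (h25 : G.Adj v2 v5)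
    (h34 : ¬ G.Adj v3 v4) (h35 : G.Adj v3 v5) (h45 : ¬ G.Adj v4 v5) (n03 : v0 ≠ v3)
    (n05 : v0 ≠ v5) (n34 : v3 ≠ v4) (n45 : v4 ≠ v5) :
    False := by
  refine h ⟨embeddingOfTuple ![v0, v1, v2, v3, v4, v5] ?_⟩
  simp [Fin.forall_fin_succ, ofEdges, *]

lemma not_G7 (h : ¬ G7 ⊴ G) (v0 v1 v2 v3 v4 v5 : V)
    (h01 : G.Adj v0 v1) (h02 : G.Adj v0 v2) (h03 : ¬ G.Adj v0 v3) (h04 : G.Adj v0 v4)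
    (h05 : ¬ G.Adj v0 v5) (h12 : G.Adj v1 v2) (h13 : G.Adj v1 v3) (h14 : ¬ G.Adj v1 v4)
    (h15 : ¬ G.Adj v1 v5) (h23 : G.Adj v2 v3) (h24 : ¬ G.Adj v2 v4) (h25 : ¬ G.Adj v2 v5)
    (h34 : ¬ G.Adj v3 v4) (h35 : G.Adj v3 v5) (h45 : G.Adj v4 v5) (n03 : v0 ≠ v3) (n05 : v0 ≠ v5)
    (n14 : v1 ≠ v4) (n15 : v1 ≠ v5) (n24 : v2 ≠ v4) (n25 : v2 ≠ v5) (n34 : v3 ≠ v4) :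
    False := by
  refine h ⟨embeddingOfTuple ![v0, v1, v2, v3, v4, v5] ?_⟩
  simp [Fin.forall_fin_succ, ofEdges, *]

lemma not_G8 (h : ¬ G8 ⊴ G) (v0 v1 v2 v3 v4 v5 : V)
    (h01 : G.Adj v0 v1) (h02 : G.Adj v0 v2) (h03 : ¬ G.Adj v0 v3) (h04 : G.Adj v0 v4)
    (h05 : ¬ G.Adj v0 v5) (h12 : G.Adj v1 v2) (h13 : G.Adj v1 v3) (h14 : ¬ G.Adj v1 v4)
    (h15 : G.Adj v1 v5) (h23 : G.Adj v2 v3) (h24 : G.Adj v2 v4) (h25 : ¬ G.Adj v2 v5)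
    (h34 : ¬ G.Adj v3 v4) (h35 : G.Adj v3 v5) (h45 : ¬ G.Adj v4 v5) (n03 : v0 ≠ v3)
    (n05 : v0 ≠ v5) (n14 : v1 ≠ v4) (n25 : v2 ≠ v5) (n34 : v3 ≠ v4) (n45 : v4 ≠ v5) :
    False := by
  refine h ⟨embeddingOfTuple ![v0, v1, v2, v3, v4, v5] ?_⟩
  simp [Fin.forall_fin_succ, ofEdges, *]

lemma not_G9 (h : ¬ G9 ⊴ G) (v0 v1 v2 v3 v4 v5 : V)
    (h01 : G.Adj v0 v1) (h02 : G.Adj v0 v2) (h03 : ¬ G.Adj v0 v3) (h04 : G.Adj v0 v4)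
    (h05 : ¬ G.Adj v0 v5) (h12 : G.Adj v1 v2) (h13 : G.Adj v1 v3) (h14 : G.Adj v1 v4)
    (h15 : G.Adj v1 v5) (h23 : G.Adj v2 v3) (h24 : ¬ G.Adj v2 v4) (h25 : ¬ G.Adj v2 v5)
    (h34 : ¬ G.Adj v3 v4) (h35 : G.Adj v3 v5) (h45 : G.Adj v4 v5) (n03 : v0 ≠ v3) (n05 : v0 ≠ v5)
    (n24 : v2 ≠ v4) (n25 : v2 ≠ v5) (n34 : v3 ≠ v4) :
    False := by
  refine h ⟨embeddingOfTuple ![v0, v1, v2, v3, v4, v5] ?_⟩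
  simp [Fin.forall_fin_succ, ofEdges, *]

/-- None of `G₁, …, G₇` is an induced subgraph. -/
structure SevenFree (G : SimpleGraph V) : Prop where
  g1 : ¬ G1 ⊴ G
  g2 : ¬ G2 ⊴ G
  g3 : ¬ G3 ⊴ G
  g4 : ¬ G4 ⊴ G
  g5 : ¬ G5 ⊴ G
  g6 : ¬ G6 ⊴ G
  g7 : ¬ G7 ⊴ G

/-! ### Odd triangles that share an edge -/

/-- Some vertex is adjacent to an odd number of `a, b, c`. For a triangle such a vertex lies
outside of it. -/
def IsOdd (G : SimpleGraph V) (a b c : V) : Prop :=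
  ∃ x, ((G.Adj x a ↔ G.Adj x b) ↔ G.Adj x c)

/-- By parity `x` sees both or neither of `a`, `d`. If neither, it sees exactly one of `b`, `c`,
which is then the centre of a claw with leaves `a`, `d`, `x`. If both, it sees none or both of `b`,
`c`, giving `G2` or `G3`. -/
lemma not_odd_both_one (h : SevenFree G) {a b c d x : V}
    (hab : G.Adj a b) (hac : G.Adj a c) (hbc : G.Adj b c) (hbd : G.Adj b d) (hcd : G.Adj c d)
    (had : ¬ G.Adj a d) (nad : a ≠ d) (hx : (G.Adj x a ↔ G.Adj x b) ↔ G.Adj x c)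
    (hx' : (G.Adj x b ↔ G.Adj x c) ↔ G.Adj x d) : False := by
  have nxa : a ≠ x := by rintro rfl; simp_all
  have nxb : b ≠ x := by rintro rfl; simp_all [G.adj_comm]
  have nxc : c ≠ x := by rintro rfl; simp_all [G.adj_comm]
  have nxd : d ≠ x := by rintro rfl; simp_all [G.adj_comm]
  have := not_G1 h.g1 b a d x
  have := not_G1 h.g1 c a d x
  have := not_G2 h.g2 a b c d x
  have := not_G3 h.g3 a b c d x
  grind [G.adj_comm, G.irrefl]

lemma not_odd_both_two (h : SevenFree G) (h8 : ¬ G8 ⊴ G) (h9 : ¬ G9 ⊴ G) {a b c d x y : V}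
    (hab : G.Adj a b) (hac : G.Adj a c) (hbc : G.Adj b c) (hbd : G.Adj b d) (hcd : G.Adj c d)
    (had : ¬ G.Adj a d) (nad : a ≠ d) (hx : (G.Adj x a ↔ G.Adj x b) ↔ G.Adj x c)
    (hx' : ¬ ((G.Adj x b ↔ G.Adj x c) ↔ G.Adj x d))
    (hy' : ¬ ((G.Adj y a ↔ G.Adj y b) ↔ G.Adj y c))
    (hy : (G.Adj y b ↔ G.Adj y c) ↔ G.Adj y d) : False := by
  have nxy : x ≠ y := by rintro rfl; exact hx' hy
  have nxa : a ≠ x := by rintro rfl; simp_all [G.adj_comm]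
  have nxb : b ≠ x := by rintro rfl; simp_all [G.adj_comm]
  have nxc : c ≠ x := by rintro rfl; simp_all [G.adj_comm]
  have nxd : d ≠ x := by rintro rfl; simp_all [G.adj_comm]
  have nya : a ≠ y := by rintro rfl; simp_all [G.adj_comm]
  have nyb : b ≠ y := by rintro rfl; simp_all [G.adj_comm]
  have nyc : c ≠ y := by rintro rfl; simp_all [G.adj_comm]
  have nyd : d ≠ y := by rintro rfl; simp_all [G.adj_comm]
  have := not_G1 h.g1 a b x y
  have := not_G1 h.g1 a c x y
  have := not_G1 h.g1 b a x y
  have := not_G1 h.g1 b c x y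
  have := not_G1 h.g1 b d x y
  have := not_G1 h.g1 c a x y
  have := not_G1 h.g1 c b x y
  have := not_G1 h.g1 c d x y
  have := not_G1 h.g1 d b x y
  have := not_G1 h.g1 d c x y
  have := not_G2 h.g2 a b c y x
  have := not_G2 h.g2 c a b y x
  have := not_G2 h.g2 c b d x y
  have := not_G2 h.g2 d b c x y
  have := not_G3 h.g3 b a c y x
  have := not_G3 h.g3 b c d x y
  have := not_G3 h.g3 c a b y x
  have := not_G3 h.g3 c b d x y
  have := not_G3 h.g3 d b c x y
  have := not_G4 h.g4 a b c d x y
  have := not_G5 h.g5 a b c d x y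
  have := not_G5 h.g5 d b c a y x
  have := not_G6 h.g6 a b c d x y
  have := not_G7 h.g7 a b c d x y
  have := not_G8 h8 a b c d y x
  have := not_G8 h8 a c b d y x
  have := not_G8 h8 b a c y d x
  have := not_G8 h8 b d c x a y
  have := not_G8 h8 c a b y d x
  have := not_G8 h8 c d b x a y
  have := not_G9 h9 a b c d y x
  have := not_G9 h9 a c b d y x
  -- By the parity conditions these five adjacencies determine all the others: if `x` sees `a`, it
  -- treats `b` and `c` alike and misses `d`; otherwise it sees `d` and exactly one of `b`, `c`. The
  -- same holds for `y` with `a` and `d` exchanged.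
  by_cases x1 : G.Adj x a <;> by_cases x2 : G.Adj x b <;> by_cases y1 : G.Adj y d <;>
    by_cases y2 : G.Adj y b <;> by_cases xy : G.Adj x y <;> grind [G.adj_comm, G.irrefl]

lemma not_odd_and_odd (h : SevenFree G) (h8 : ¬ G8 ⊴ G) (h9 : ¬ G9 ⊴ G) {a b c d : V}
    (hab : G.Adj a b) (hac : G.Adj a c) (hbc : G.Adj b c) (hbd : G.Adj b d) (hcd : G.Adj c d)
    (had : ¬ G.Adj a d) (nad : a ≠ d) (h1 : IsOdd G a b c) (h2 : IsOdd G b c d) : False := by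
  obtain ⟨x, hx⟩ := h1
  obtain ⟨y, hy⟩ := h2
  by_cases hx' : (G.Adj x b ↔ G.Adj x c) ↔ G.Adj x d
  · exact not_odd_both_one h hab hac hbc hbd hcd had nad hx hx'
  by_cases hy' : (G.Adj y a ↔ G.Adj y b) ↔ G.Adj y c
  · exact not_odd_both_one h hab hac hbc hbd hcd had nad hy' hy
  exact not_odd_both_two h h8 h9 hab hac hbc hbd hcd had nad hx hx' hy' hy

/-! ### The partition of the edges into odd cliques -/

/-- `f` exhibits `G` as the line graph of the graph with edge set `Set.range f`. -/
structure IsRootMap {W : Type*} (G : SimpleGraph V) (f : V → Sym2 W) : Prop where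
  injective : Function.Injective f
  not_isDiag : ∀ v, ¬ (f v).IsDiag
  adj_iff : ∀ u v, u ≠ v → (G.Adj u v ↔ ∃ w, w ∈ f u ∧ w ∈ f v)

lemma IsOdd.rotate {a b c : V} (h : IsOdd G a b c) : IsOdd G b c a := by
  obtain ⟨x, hx⟩ := h
  exact ⟨x, by tauto⟩

lemma IsOdd.swap {a b c : V} (h : IsOdd G a b c) : IsOdd G b a c := by
  obtain ⟨x, hx⟩ := h
  exact ⟨x, by tauto⟩

/-- The vertices `u`, `v` and the apexes of the odd triangles on the edge `uv`. -/
def oddClique (G : SimpleGraph V) (u v : V) : Set V :=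
  {w | w = u ∨ w = v ∨ G.Adj w u ∧ G.Adj w v ∧ IsOdd G u v w}

lemma oddClique_comm (u v : V) : oddClique G u v = oddClique G v u := by
  ext w
  have := @IsOdd.swap V G u v w
  have := @IsOdd.swap V G v u w
  simp only [oddClique, Set.mem_ofPred_eq]
  tauto

lemma left_mem_oddClique (u v : V) : u ∈ oddClique G u v := Or.inl rfl

lemma right_mem_oddClique (u v : V) : v ∈ oddClique G u v := Or.inr (Or.inl rfl)

/-- Two triangles sharing an edge, with nonadjacent apexes, are not both odd. -/
def NoOddDiamond (G : SimpleGraph V) : Prop :=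
  ∀ ⦃a b c d : V⦄, G.Adj a b → G.Adj a c → G.Adj b c → G.Adj b d → G.Adj c d → ¬ G.Adj a d →
    a ≠ d → IsOdd G a b c → ¬ IsOdd G b c d

/-- Two triangles sharing an edge, with nonadjacent apexes, are not both even. -/
def NoEvenDiamond (G : SimpleGraph V) : Prop :=
  ∀ ⦃a b c d : V⦄, G.Adj a b → G.Adj a c → G.Adj b c → G.Adj b d → G.Adj c d → ¬ G.Adj a d →
    a ≠ d → ¬ IsOdd G a b c → IsOdd G b c d

/-- The odd triangles `u v w` and `u w x` share the edge `uw`, so their apexes `v` and `x` are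
adjacent or equal. In the first case `u v x` is again odd, because `w` sees all three of its
vertices. -/
lemma NoOddDiamond.oddClique_subset (ho : NoOddDiamond G) {u v w : V} (huv : G.Adj u v)
    (hw : w ∈ oddClique G u v) (hwu : w ≠ u) : oddClique G u w ⊆ oddClique G u v := by
  rintro x (rfl | rfl | ⟨hxu, hxw, hx⟩)
  · exact left_mem_oddClique _ _
  · exact hw
  rcases hw with hw | rfl | ⟨hwu', hwv, hw⟩
  · exact absurd hw hwu
  · exact Or.inr (Or.inr ⟨hxu, hxw, hx⟩)
  by_cases hxv : x = v
  · exact hxv ▸ right_mem_oddClique _ _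
  have hadj : G.Adj x v := by
    by_contra hn
    exact ho huv.symm hwv.symm hwu'.symm hxu.symm hxw.symm (fun h => hn h.symm) (Ne.symm hxv)
      hw.swap hx
  exact Or.inr (Or.inr ⟨hxu, hadj, w, by simp [hwu', hwv, hxw.symm]⟩)

lemma adj_of_mem_oddClique {u v w : V} (huv : G.Adj u v) (hw : w ∈ oddClique G u v)
    (hwu : w ≠ u) : G.Adj u w := by
  rcases hw with hw | rfl | hw
  · exact absurd hw hwu
  · exact huv
  · exact hw.1.symm

lemma NoOddDiamond.oddClique_eq (ho : NoOddDiamond G) {u v w : V} (huv : G.Adj u v)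
    (hw : w ∈ oddClique G u v) (hwu : w ≠ u) : oddClique G u w = oddClique G u v := by
  refine (ho.oddClique_subset huv hw hwu).antisymm
    (ho.oddClique_subset (adj_of_mem_oddClique huv hw hwu) ?_ huv.ne')
  rcases hw with hw | rfl | ⟨h1, h2, h3⟩
  · exact absurd hw hwu
  · exact right_mem_oddClique _ _
  · exact Or.inr (Or.inr ⟨huv.symm, h2.symm, h3.swap.rotate⟩)

/-- This makes the odd cliques a partition of the edge set: an odd clique is recovered from any two
of its members. -/
lemma NoOddDiamond.oddClique_pair (ho : NoOddDiamond G) {u v x y : V} (huv : G.Adj u v)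
    (hx : x ∈ oddClique G u v) (hy : y ∈ oddClique G u v) (hxy : x ≠ y) :
    G.Adj x y ∧ oddClique G x y = oddClique G u v := by
  by_cases hxu : x = u
  · subst hxu
    exact ⟨adj_of_mem_oddClique huv hy hxy.symm, ho.oddClique_eq huv hy hxy.symm⟩
  have hux := adj_of_mem_oddClique huv hx hxu
  have h1 := ho.oddClique_eq huv hx hxu
  rw [← h1, oddClique_comm] at hy
  exact ⟨adj_of_mem_oddClique hux.symm hy hxy.symm,
    (ho.oddClique_eq hux.symm hy hxy.symm).trans ((oddClique_comm _ _).trans h1)⟩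

/-- Since `v a b` is even and `c` sees `v`, `c` sees exactly one of `a`, `b`. The triangle this
creates forms a diamond with `v a b`, so it cannot be even too. -/
lemma NoEvenDiamond.isOdd_of_adj (he : NoEvenDiamond G) {v a b c : V} (ha : G.Adj v a)
    (hb : G.Adj v b) (hc : G.Adj v c) (hbc : b ≠ c) (hac : a ≠ c) (hab : G.Adj a b)
    (h : ¬ IsOdd G v a b) : G.Adj a c ∧ IsOdd G v a c ∨ G.Adj b c ∧ IsOdd G v b c := by
  have hc' : ¬ ((G.Adj c v ↔ G.Adj c a) ↔ G.Adj c b) := fun h' => h ⟨c, h'⟩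
  simp only [hc.symm, true_iff, G.adj_comm c] at hc'
  by_cases h1 : G.Adj a c
  · have h2 : ¬ G.Adj b c := by tauto
    exact Or.inl ⟨h1, he hb.symm hab.symm ha hc h1 h2 hbc fun h' => h h'.rotate⟩
  · have h2 : G.Adj b c := by tauto
    exact Or.inr ⟨h2, he ha.symm hab hb hc h2 h1 hac fun h' => h h'.swap⟩

/-- At most two odd cliques pass through a vertex. Without a claw, two of the three neighbours are
adjacent; either they span an odd triangle with `v`, or the third neighbour spans one with one of
them. -/
lemma oddClique_pigeonhole (hclaw : ¬ G1 ⊴ G) (ho : NoOddDiamond G) (he : NoEvenDiamond G)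
    {v a b c : V} (ha : G.Adj v a) (hb : G.Adj v b) (hc : G.Adj v c) :
    oddClique G v a = oddClique G v b ∨ oddClique G v a = oddClique G v c ∨
      oddClique G v b = oddClique G v c := by
  have key : ∀ {x y : V}, G.Adj v x → G.Adj x y ∧ IsOdd G v x y → G.Adj v y →
      oddClique G v x = oddClique G v y := fun hx hxy hy =>
    (ho.oddClique_eq hx (Or.inr (Or.inr ⟨hy.symm, hxy.1.symm, hxy.2⟩)) hy.ne').symm
  by_cases nab : a = b
  · simp [nab]
  by_cases nac : a = c
  · simp [nac]
  by_cases nbc : b = c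
  · simp [nbc]
  by_cases hab : G.Adj a b
  · by_cases h : IsOdd G v a b
    · exact Or.inl (key ha ⟨hab, h⟩ hb)
    · rcases he.isOdd_of_adj ha hb hc nbc nac hab h with h | h
      · exact Or.inr (Or.inl (key ha h hc))
      · exact Or.inr (Or.inr (key hb h hc))
  by_cases hac : G.Adj a c
  · by_cases h : IsOdd G v a c
    · exact Or.inr (Or.inl (key ha ⟨hac, h⟩ hc))
    · rcases he.isOdd_of_adj ha hc hb (Ne.symm nbc) nab hac h with h | h
      · exact Or.inl (key ha h hb)
      · exact Or.inr (Or.inr (key hc h hb).symm)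
  by_cases hbc : G.Adj b c
  · by_cases h : IsOdd G v b c
    · exact Or.inr (Or.inr (key hb ⟨hbc, h⟩ hc))
    · rcases he.isOdd_of_adj hb hc ha (Ne.symm nac) (Ne.symm nab) hbc h with h | h
      · exact Or.inl (key hb h ha).symm
      · exact Or.inr (Or.inl (key hc h ha).symm)
  exact (not_G1 hclaw v a b c ha hb hc hab hac hbc nab nac nbc).elim

/-- The members of `z` are the odd cliques through `v`, filled up to two members with labels that
are private to `v`. -/
def IsRootEdge (G : SimpleGraph V) (v : V) (z : Sym2 (Set V ⊕ V × Bool)) : Prop :=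
  ¬ z.IsDiag ∧ (∀ C, Sum.inl C ∈ z ↔ ∃ u, G.Adj v u ∧ C = oddClique G v u) ∧
    ∀ p, Sum.inr p ∈ z → p.1 = v

lemma exists_isRootEdge (hclaw : ¬ G1 ⊴ G) (ho : NoOddDiamond G) (he : NoEvenDiamond G) (v : V) :
    ∃ z, IsRootEdge G v z := by
  by_cases h : ∃ a, G.Adj v a
  swap
  · push Not at h
    exact ⟨s(Sum.inr (v, false), Sum.inr (v, true)), by simp [IsRootEdge, h]⟩
  obtain ⟨a, ha⟩ := h
  by_cases h : ∃ b, G.Adj v b ∧ oddClique G v a ≠ oddClique G v b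
  · obtain ⟨b, hb, hab⟩ := h
    refine ⟨s(Sum.inl (oddClique G v a), Sum.inl (oddClique G v b)), by simpa using hab,
      fun C => ?_, by simp⟩
    simp only [Sym2.mem_iff, Sum.inl.injEq]
    constructor
    · rintro (rfl | rfl)
      exacts [⟨a, ha, rfl⟩, ⟨b, hb, rfl⟩]
    · rintro ⟨c, hc, rfl⟩
      have := oddClique_pigeonhole hclaw ho he ha hb hc
      tauto
  · push Not at h
    refine ⟨s(Sum.inl (oddClique G v a), Sum.inr (v, false)), by simp, fun C => ?_, ?_⟩
    · simp only [Sym2.mem_iff, Sum.inl.injEq, reduceCtorEq, or_false]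
      exact ⟨fun hC => ⟨a, ha, hC⟩, fun ⟨c, hc, hC⟩ => hC.trans (h c hc).symm⟩
    · simp

lemma exists_isRootMap_of_noDiamond (hclaw : ¬ G1 ⊴ G) (ho : NoOddDiamond G)
    (he : NoEvenDiamond G) : ∃ f : V → Sym2 (Set V ⊕ V × Bool), IsRootMap G f := by
  choose f hf using exists_isRootEdge hclaw ho he
  have key : ∀ u v w, u ≠ v → w ∈ f u → w ∈ f v →
      G.Adj u v ∧ w = Sum.inl (oddClique G u v) := by
    rintro u v (C | p) huv hu hv
    · obtain ⟨u', hu', hC⟩ := ((hf u).2.1 C).1 hu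
      obtain ⟨v', hv', hC'⟩ := ((hf v).2.1 C).1 hv
      have := ho.oddClique_pair hu' (left_mem_oddClique u u')
        (hC ▸ hC' ▸ left_mem_oddClique v v') huv
      exact ⟨this.1, by rw [this.2, hC]⟩
    · exact absurd (((hf u).2.2 p hu).symm.trans ((hf v).2.2 p hv)) huv
  refine ⟨f, fun u v huv => ?_, fun v => (hf v).1, fun u v huv => ⟨fun h => ?_, ?_⟩⟩
  -- Distinct vertices share at most one label, the odd clique of their edge; equal values of `f`
  -- would make both ends of `f u` this label, a loop.
  · by_contra hne
    have hd := (hf u).1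
    have hk := key u v
    rw [← huv] at hk
    induction hz : f u with
    | h p q =>
      rw [hz] at hd hk
      exact hd ((hk p hne (by simp) (by simp)).2.trans (hk q hne (by simp) (by simp)).2.symm)
  · refine ⟨Sum.inl (oddClique G u v), ((hf u).2.1 _).2 ⟨v, h, rfl⟩,
      ((hf v).2.1 _).2 ⟨u, h.symm, oddClique_comm _ _⟩⟩
  · rintro ⟨w, hu, hv⟩
    exact (key u v w huv hu hv).1

/-! ### Even diamonds and the octahedron -/

lemma forall_of_connected (hconn : G.Connected) {P : V → Prop} {v : V} (hv : P v)
    (hP : ∀ x, P x → ∀ y, G.Adj x y → P y) (w : V) : P w := by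
  obtain ⟨p⟩ := hconn.preconnected v w
  induction p with
  | nil => exact hv
  | cons h _ ih => exact ih (hP _ hv _ h)

/-- A connected graph with two even triangles sharing an edge is an induced subgraph of the
octahedron `L(K₄)`. -/
lemma exists_isRootMap_of_even_diamond (hconn : G.Connected) (h : SevenFree G) {a b c d : V}
    (hab : G.Adj a b) (hac : G.Adj a c) (hbc : G.Adj b c) (hbd : G.Adj b d) (hcd : G.Adj c d)
    (had : ¬ G.Adj a d) (nad : a ≠ d) (h1 : ¬ IsOdd G a b c) (h2 : ¬ IsOdd G b c d) :
    ∃ f : V → Sym2 (Fin 4), IsRootMap G f := by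
  classical
  have e1 : ∀ x, ¬ ((G.Adj x a ↔ G.Adj x b) ↔ G.Adj x c) := fun x hx => h1 ⟨x, hx⟩
  have e2 : ∀ x, ¬ ((G.Adj x b ↔ G.Adj x c) ↔ G.Adj x d) := fun x hx => h2 ⟨x, hx⟩
  -- Evenness of both triangles leaves four patterns, one for each choice of adjacency to `b` and
  -- `c`. Seeing both means missing `a` and `d`, which is a claw at `b`.
  have type : ∀ x, (x = a ∨ x = b ∨ x = c ∨ x = d) ∨
      (x ≠ a ∧ x ≠ b ∧ x ≠ c ∧ x ≠ d) ∧
      (G.Adj x a ∧ G.Adj x b ∧ ¬ G.Adj x c ∧ G.Adj x d ∨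
      G.Adj x a ∧ ¬ G.Adj x b ∧ G.Adj x c ∧ G.Adj x d ∨
      ¬ G.Adj x a ∧ ¬ G.Adj x b ∧ ¬ G.Adj x c ∧ ¬ G.Adj x d) := by
    intro x
    by_cases hx : x = a ∨ x = b ∨ x = c ∨ x = d
    · exact Or.inl hx
    push Not at hx
    refine Or.inr ⟨hx, ?_⟩
    have e1x := e1 x
    have e2x := e2 x
    by_cases xb : G.Adj x b <;> by_cases xc : G.Adj x c <;> simp [xb, xc] at e1x e2x ⊢
    · exact not_G1 h.g1 b a d x hab.symm hbd xb.symm had (fun h => e1x h.symm)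
        (fun h => e2x h.symm) nad hx.1.symm hx.2.2.2.symm
    · exact ⟨e1x, e2x⟩
    · exact ⟨e1x, e2x⟩
    · exact ⟨e1x, e2x⟩
  -- A vertex that misses the whole diamond has no neighbour among the others: such a neighbour sees
  -- `a` and `d` and would be the centre of a claw.
  have all : ∀ x, x = a ∨ x = b ∨ x = c ∨ x = d ∨
      (x ≠ a ∧ x ≠ b ∧ x ≠ c ∧ x ≠ d) ∧
      (G.Adj x a ∧ G.Adj x b ∧ ¬ G.Adj x c ∧ G.Adj x d ∨
      G.Adj x a ∧ ¬ G.Adj x b ∧ G.Adj x c ∧ G.Adj x d) := by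
    refine forall_of_connected hconn (v := a) (Or.inl rfl) ?_
    intro x hx y hxy
    rcases type y with hy | ⟨hy, hy' | hy' | hy'⟩
    · rcases hy with rfl | rfl | rfl | rfl <;> simp
    · exact Or.inr (Or.inr (Or.inr (Or.inr ⟨hy, Or.inl hy'⟩)))
    · exact Or.inr (Or.inr (Or.inr (Or.inr ⟨hy, Or.inr hy'⟩)))
    exfalso
    rcases hx with rfl | rfl | rfl | rfl | ⟨hx, hx'⟩
    · exact hy'.1 hxy.symm
    · exact hy'.2.1 hxy.symm
    · exact hy'.2.2.1 hxy.symm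
    · exact hy'.2.2.2 hxy.symm
    · exact not_G1 h.g1 x a d y (hx'.elim (·.1) (·.1))
        (hx'.elim (·.2.2.2) (·.2.2.2)) hxy had (fun h => hy'.1 h.symm)
        (fun h => hy'.2.2.2 h.symm) nad hy.1.symm hy.2.2.2.symm
  -- Outside the diamond, `B` is the antipode of `c` in the octahedron and `C` that of `b`. The
  -- vertex `c` itself satisfies `B` and `b` satisfies `C`, hence the exclusions in the uniqueness
  -- claims.
  let B := fun x => G.Adj x a ∧ G.Adj x b ∧ ¬ G.Adj x c ∧ G.Adj x d
  let C := fun x => G.Adj x a ∧ ¬ G.Adj x b ∧ G.Adj x c ∧ G.Adj x d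
  have uB : ∀ x y, x ≠ c → y ≠ c → B x → B y → x = y := by
    rintro x y nx ny ⟨xa, xb, xc, xd⟩ ⟨ya, yb, yc, yd⟩
    by_contra hne
    by_cases hxy : G.Adj x y
    · exact not_G3 h.g3 a b x d y hab xa.symm had ya.symm xb.symm hbd yb.symm xd hxy yd.symm nad
    · exact not_G1 h.g1 a c x y hac xa.symm ya.symm (fun h => xc h.symm) (fun h => yc h.symm) hxy
        nx.symm ny.symm hne
  have uC : ∀ x y, x ≠ b → y ≠ b → C x → C y → x = y := by
    rintro x y nx ny ⟨xa, xb, xc, xd⟩ ⟨ya, yb, yc, yd⟩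
    by_contra hne
    by_cases hxy : G.Adj x y
    · exact not_G3 h.g3 a c x d y hac xa.symm had ya.symm xc.symm hcd yc.symm xd hxy yd.symm nad
    · exact not_G1 h.g1 a b x y hab xa.symm ya.symm (fun h => xb h.symm) (fun h => yb h.symm) hxy
        nx.symm ny.symm hne
  have BC : ∀ x y, y ≠ b → B x → C y → G.Adj x y := by
    rintro x y ny ⟨xa, xb, xc, xd⟩ ⟨ya, yb, yc, yd⟩
    by_contra hne
    exact not_G2 h.g2 a b x d y hab xa.symm had ya.symm xb.symm hbd (fun h => yb h.symm) xd hne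
      yd.symm nad ny.symm (by rintro rfl; exact yb xb)
  -- Antipodal vertices of the octahedron receive disjoint edges of `K₄`: `01` and `23`, `02` and
  -- `13`, `03` and `12`.
  let f : V → Sym2 (Fin 4) := fun x => if x = a then s(0, 1) else if x = b then s(0, 2) else
    if x = c then s(0, 3) else if x = d then s(2, 3) else if G.Adj x b then s(1, 2) else s(1, 3)
  have fa : f a = s(0, 1) := by simp [f]
  have fb : f b = s(0, 2) := by simp [f, hab.ne']
  have fc : f c = s(0, 3) := by simp [f, hac.ne', hbc.ne']
  have fd : f d = s(2, 3) := by simp [f, nad.symm, hbd.ne', hcd.ne']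
  have fB : ∀ x, (x ≠ a ∧ x ≠ b ∧ x ≠ c ∧ x ≠ d) → B x → f x = s(1, 2) := by
    intro x hx hB
    simp [f, hx, hB.2.1]
  have fC : ∀ x, (x ≠ a ∧ x ≠ b ∧ x ≠ c ∧ x ≠ d) → C x → f x = s(1, 3) := by
    intro x hx hC
    simp [f, hx, hC.2.1]
  refine ⟨f, ?_, ?_, ?_⟩
  · intro x y hxy
    rcases all x with rfl | rfl | rfl | rfl | ⟨hx, hx' | hx'⟩ <;>
    rcases all y with rfl | rfl | rfl | rfl | ⟨hy, hy' | hy'⟩ <;>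
    first
    | rfl
    | exact uB _ _ hx.2.2.1 hy.2.2.1 hx' hy'
    | exact uC _ _ hx.2.1 hy.2.1 hx' hy'
    | (exfalso
       first | rw [fB _ hx hx'] at hxy | rw [fC _ hx hx'] at hxy | skip
       first | rw [fB _ hy hy'] at hxy | rw [fC _ hy hy'] at hxy | skip
       simp [fa, fb, fc, fd] at hxy)
  · intro x
    rcases all x with rfl | rfl | rfl | rfl | ⟨hx, hx' | hx'⟩
    · simp [fa]
    · simp [fb]
    · simp [fc]
    · simp [fd]
    · simp [fB _ hx hx']
    · simp [fC _ hx hx']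
  · intro x y hxy
    rcases all x with rfl | rfl | rfl | rfl | ⟨hx, hx' | hx'⟩ <;>
    rcases all y with rfl | rfl | rfl | rfl | ⟨hy, hy' | hy'⟩ <;>
    first
    | exact absurd rfl hxy
    | exact absurd (uB _ _ hx.2.2.1 hy.2.2.1 hx' hy') hxy
    | exact absurd (uC _ _ hx.2.1 hy.2.1 hx' hy') hxy
    | ((try have := BC _ _ hy.2.1 hx' hy')
       (try have := BC _ _ hx.2.1 hy' hx')
       (first | rw [fB _ hx hx'] | rw [fC _ hx hx'] | skip)
       (first | rw [fB _ hy hy'] | rw [fC _ hy hy'] | skip)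
       clear type all e1 e2 uB uC BC fB fC
       simp_all [G.adj_comm])

/-! ### From a labelling to a connected root -/

lemma IsRootMap.exists_iso_lineGraph {W : Type*} {f : V → Sym2 W} (hf : IsRootMap G f) :
    ∃ H : SimpleGraph W, Nonempty (G ≃g H.lineGraph) := by
  have hE : (fromEdgeSet (Set.range f)).edgeSet = Set.range f := by
    rw [edgeSet_fromEdgeSet, sdiff_eq_left, Set.disjoint_left]
    rintro _ ⟨v, rfl⟩
    exact hf.not_isDiag v
  let e : V ≃ (fromEdgeSet (Set.range f)).edgeSet :=
    (Equiv.ofInjective f hf.injective).trans (Equiv.setCongr hE.symm)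
  have he : ∀ v, ((e v : _) : Sym2 W) = f v := fun v => rfl
  refine ⟨fromEdgeSet (Set.range f), ⟨⟨e, fun {u v} => ?_⟩⟩⟩
  rw [lineGraph_adj_iff_exists, he, he, e.injective.ne_iff]
  exact ⟨fun h => (hf.adj_iff u v h.1).2 h.2, fun h => ⟨h.ne, (hf.adj_iff u v h.ne).1 h⟩⟩

/-- Deleting the isolated vertices does not change the line graph. -/
lemma nonempty_iso_lineGraph_support {W : Type*} (H : SimpleGraph W) :
    Nonempty (H.lineGraph ≃g (H.induce H.support).lineGraph) := by
  let φ := (Embedding.induce H.support : H.induce H.support ↪g H).toCopy.toLineGraphEmbedding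
  refine ⟨(RelIso.ofSurjective φ ?_).symm⟩
  rintro ⟨e, he⟩
  induction e with
  | h x y =>
    have hxy : H.Adj x y := he
    exact ⟨⟨s(⟨x, y, hxy⟩, ⟨y, x, hxy.symm⟩), hxy⟩, rfl⟩

lemma connected_of_lineGraph {W : Type*} {H : SimpleGraph W} (hH : ∀ x, ∃ y, H.Adj x y)
    (hL : H.lineGraph.Connected) : H.Connected := by
  have step : ∀ e e' : H.edgeSet, H.lineGraph.Reachable e e' →
      ∀ x ∈ (e : Sym2 W), ∀ y ∈ (e' : Sym2 W), H.Reachable x y := by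
    have edge : ∀ e : H.edgeSet, ∀ x ∈ (e : Sym2 W), ∀ y ∈ (e : Sym2 W), H.Reachable x y := by
      rintro ⟨e, he⟩ x hx y hy
      by_cases hxy : x = y
      · exact hxy ▸ Reachable.refl _
      · obtain rfl := (Sym2.mem_and_mem_iff hxy).1 ⟨hx, hy⟩
        exact Adj.reachable he
    rintro e e' ⟨p⟩
    induction p with
    | nil => exact edge _
    | cons h _ ih =>
      intro x hx y hy
      obtain ⟨-, w, hw, hw'⟩ := lineGraph_adj_iff_exists.1 h
      exact (edge _ x hx w hw).trans (ih w hw' y hy)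
  have : Nonempty W := by
    obtain ⟨⟨e, -⟩⟩ := hL.nonempty
    induction e with
    | h x y => exact ⟨x⟩
  refine ⟨fun x y => ?_⟩
  obtain ⟨x', hx⟩ := hH x
  obtain ⟨y', hy⟩ := hH y
  exact step ⟨s(x, x'), hx⟩ ⟨s(y, y'), hy⟩ (hL.preconnected _ _) x (by simp) y (by simp)

/-- Connectedness of a line graph does not see isolated vertices of the root, so the root is first
cut down to its support. -/
lemma exists_connected_root {W : Type*} [Finite W] {H : SimpleGraph W} (hG : G.Connected)
    (hH : Nonempty (G ≃g H.lineGraph)) :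
    ∃ (n : ℕ) (K : SimpleGraph (Fin n)), K.Connected ∧ Nonempty (G ≃g K.lineGraph) := by
  obtain ⟨φ⟩ := hH
  obtain ⟨ψ⟩ := nonempty_iso_lineGraph_support H
  have hc : (H.induce H.support).Connected :=
    connected_of_lineGraph (fun ⟨x, y, hxy⟩ => ⟨⟨y, x, hxy.symm⟩, hxy⟩)
      ((Iso.connected_iff (φ.trans ψ)).1 hG)
  have := Fintype.ofFinite H.support
  let χ := (H.induce H.support).overFinIso rfl
  exact ⟨_, _, (Iso.connected_iff χ).1 hc, ⟨(φ.trans ψ).trans χ.lineGraph⟩⟩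

/-- **Beineke's theorem** for connected graphs. -/
theorem exists_root [Finite V] (hconn : G.Connected) (h : SevenFree G) (h8 : ¬ G8 ⊴ G)
    (h9 : ¬ G9 ⊴ G) :
    ∃ (n : ℕ) (K : SimpleGraph (Fin n)), K.Connected ∧ Nonempty (G ≃g K.lineGraph) := by
  by_cases he : NoEvenDiamond G
  · have ho : NoOddDiamond G := fun _ _ _ _ hab hac hbc hbd hcd had nad h1 h2 =>
      not_odd_and_odd h h8 h9 hab hac hbc hbd hcd had nad h1 h2
    obtain ⟨f, hf⟩ := exists_isRootMap_of_noDiamond h.g1 ho he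
    obtain ⟨H, hH⟩ := hf.exists_iso_lineGraph
    exact exists_connected_root hconn hH
  · simp only [NoEvenDiamond, not_forall] at he
    obtain ⟨a, b, c, d, hab, hac, hbc, hbd, hcd, had, nad, h1, h2⟩ := he
    obtain ⟨f, hf⟩ := exists_isRootMap_of_even_diamond hconn h hab hac hbc hbd hcd had nad h1 h2
    obtain ⟨H, hH⟩ := hf.exists_iso_lineGraph
    exact exists_connected_root hconn hH

/-! ### Vertices attached to a copy of `G8` or `G9` -/

lemma nonempty_iso_of_tuple {n : ℕ} {S : SimpleGraph (Fin n)} (p : Fin n → V)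
    (hp : ∀ i j, i < j → (S.Adj i j ∨ p i ≠ p j) ∧ (G.Adj (p i) (p j) ↔ S.Adj i j))
    (hs : ∀ v, ∃ i, p i = v) : Nonempty (G ≃g S) :=
  ⟨(RelIso.ofSurjective (embeddingOfTuple p hp) hs).symm⟩

/-- The vertex `x` is outside of the copy `φ`, and its neighbours in `φ` are given by `S`. -/
structure Attaches {n : ℕ} {K : SimpleGraph (Fin n)} (φ : K ↪g G) (x : V) (S : Finset (Fin n)) :
    Prop where
  ne : ∀ i, x ≠ φ i
  adj : ∀ i, G.Adj x (φ i) ↔ i ∈ S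

section

variable {n : ℕ} {K : SimpleGraph (Fin n)} {φ : K ↪g G} {x : V} {S : Finset (Fin n)}

lemma Attaches.ne' (hx : Attaches φ x S) (i : Fin n) : φ i ≠ x := (hx.ne i).symm

lemma Attaches.adj' (hx : Attaches φ x S) (i : Fin n) : G.Adj (φ i) x ↔ i ∈ S :=
  (G.adj_comm _ _).trans (hx.adj i)

end

/-- Every other subset of the six vertices, taken as the neighbourhood of `x`, completes one of the
listed obstructions. Reversing the path `4, 0, 2, 1, 3, 5` exchanges the second type with the third
and the fourth with the fifth. -/
lemma attaches_G8 (h : SevenFree G) (φ : G8 ↪g G) {x : V} (hx : ∀ i, x ≠ φ i) :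
    Attaches φ x ∅ ∨ Attaches φ x {0, 4} ∨ Attaches φ x {3, 5} ∨ Attaches φ x {0, 1, 5} ∨
      Attaches φ x {2, 3, 4} := by
  suffices H : (∀ i, G.Adj x (φ i) ↔ i ∈ (∅ : Finset (Fin 6))) ∨
      (∀ i, G.Adj x (φ i) ↔ i ∈ ({0, 4} : Finset (Fin 6))) ∨
      (∀ i, G.Adj x (φ i) ↔ i ∈ ({3, 5} : Finset (Fin 6))) ∨
      (∀ i, G.Adj x (φ i) ↔ i ∈ ({0, 1, 5} : Finset (Fin 6))) ∨
      (∀ i, G.Adj x (φ i) ↔ i ∈ ({2, 3, 4} : Finset (Fin 6))) by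
    rcases H with H | H | H | H | H
    exacts [Or.inl ⟨hx, H⟩, Or.inr (Or.inl ⟨hx, H⟩), Or.inr (Or.inr (Or.inl ⟨hx, H⟩)),
      Or.inr (Or.inr (Or.inr (Or.inl ⟨hx, H⟩))), Or.inr (Or.inr (Or.inr (Or.inr ⟨hx, H⟩)))]
  have hc : ∀ i, G.Adj (φ i) x ↔ G.Adj x (φ i) := fun i => G.adj_comm _ _
  have hn : ∀ i, φ i ≠ x := fun i => (hx i).symm
  have k0 := not_G1 h.g1 (φ 0) (φ 1) (φ 4) x
  have k1 := not_G1 h.g1 (φ 1) (φ 0) (φ 3) x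
  have k2 := not_G1 h.g1 (φ 1) (φ 0) (φ 5) x
  have k3 := not_G1 h.g1 (φ 1) (φ 2) (φ 5) x
  have k4 := not_G1 h.g1 (φ 2) (φ 0) (φ 3) x
  have k5 := not_G1 h.g1 (φ 2) (φ 1) (φ 4) x
  have k6 := not_G1 h.g1 (φ 2) (φ 3) (φ 4) x
  have k7 := not_G1 h.g1 (φ 3) (φ 2) (φ 5) x
  have k8 := not_G2 h.g2 (φ 1) (φ 3) (φ 5) x (φ 0)
  have k9 := not_G2 h.g2 (φ 2) (φ 1) (φ 3) (φ 5) x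
  have k10 := not_G2 h.g2 (φ 2) (φ 1) (φ 3) x (φ 4)
  have k11 := not_G3 h.g3 (φ 0) (φ 1) (φ 2) (φ 3) x
  have k12 := not_G3 h.g3 (φ 1) (φ 0) (φ 2) (φ 4) x
  have k13 := not_G3 h.g3 (φ 2) (φ 1) (φ 3) (φ 5) x
  have k14 := not_G4 h.g4 (φ 1) (φ 0) (φ 2) (φ 4) (φ 5) x
  have k15 := not_G4 h.g4 (φ 2) (φ 1) (φ 3) (φ 5) (φ 4) x
  have k16 := not_G5 h.g5 (φ 4) (φ 0) (φ 2) (φ 1) x (φ 5)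
  have k17 := not_G5 h.g5 (φ 5) (φ 1) (φ 3) (φ 2) x (φ 4)
  have k18 := not_G7 h.g7 (φ 1) (φ 3) (φ 5) x (φ 0) (φ 4)
  have k19 := not_G7 h.g7 (φ 2) (φ 0) (φ 4) x (φ 3) (φ 5)
  have k20 := not_G7 h.g7 (φ 2) (φ 1) (φ 3) (φ 5) (φ 4) x
  simp [ofEdges, hc, hx, hn] at k0 k1 k2 k3 k4 k5 k6 k7 k8 k9 k10 k11 k12 k13 k14 k15 k16 k17 k18 k19 k20
  simp only [Fin.forall_fin_succ]
  by_cases x0 : G.Adj x (φ 0) <;> by_cases x1 : G.Adj x (φ 1) <;>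
  by_cases x2 : G.Adj x (φ 2) <;> by_cases x3 : G.Adj x (φ 3) <;>
  by_cases x4 : G.Adj x (φ 4) <;> by_cases x5 : G.Adj x (φ 5) <;>
  simp [x0, x1, x2, x3, x4, x5] at *

/-- Each nonempty neighbourhood of `x` in the wheel produces one of the listed configurations, `G8`
included. A copy of `G9` is therefore a whole component. -/
lemma not_adj_G9 (h : SevenFree G) (h8 : ¬ G8 ⊴ G) (φ : G9 ↪g G) {x : V} (hx : ∀ i, x ≠ φ i)
    (i : Fin 6) : ¬ G.Adj x (φ i) := by
  revert i
  have hc : ∀ i, G.Adj (φ i) x ↔ G.Adj x (φ i) := fun i => G.adj_comm _ _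
  have hn : ∀ i, φ i ≠ x := fun i => (hx i).symm
  have k0 := not_G1 h.g1 (φ 0) (φ 2) (φ 4) x
  have k1 := not_G1 h.g1 (φ 1) (φ 0) (φ 3) x
  have k2 := not_G1 h.g1 (φ 1) (φ 0) (φ 5) x
  have k3 := not_G1 h.g1 (φ 1) (φ 2) (φ 4) x
  have k4 := not_G1 h.g1 (φ 1) (φ 2) (φ 5) x
  have k5 := not_G1 h.g1 (φ 1) (φ 3) (φ 4) x
  have k6 := not_G1 h.g1 (φ 2) (φ 0) (φ 3) x
  have k7 := not_G1 h.g1 (φ 3) (φ 2) (φ 5) x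
  have k8 := not_G1 h.g1 (φ 4) (φ 0) (φ 5) x
  have k9 := not_G1 h.g1 (φ 5) (φ 3) (φ 4) x
  have k10 := not_G2 h.g2 (φ 1) (φ 3) (φ 5) x (φ 0)
  have k11 := not_G2 h.g2 (φ 1) (φ 4) (φ 5) x (φ 2)
  have k12 := not_G2 h.g2 (φ 3) (φ 1) (φ 5) (φ 4) x
  have k13 := not_G3 h.g3 (φ 2) (φ 0) (φ 1) (φ 4) x
  have k14 := not_G3 h.g3 (φ 2) (φ 1) (φ 3) (φ 5) x
  have k15 := not_G3 h.g3 (φ 3) (φ 1) (φ 5) (φ 4) x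
  have k16 := not_G7 h.g7 (φ 0) (φ 2) x (φ 3) (φ 4) (φ 5)
  have k17 := not_G7 h.g7 (φ 0) (φ 4) x (φ 5) (φ 2) (φ 3)
  have k18 := not_G8 h8 (φ 0) (φ 1) (φ 4) (φ 5) x (φ 3)
  have k19 := not_G8 h8 (φ 0) (φ 4) (φ 1) (φ 5) (φ 2) x
  have k20 := not_G8 h8 (φ 2) (φ 1) (φ 0) (φ 4) x (φ 5)
  have k21 := not_G8 h8 (φ 2) (φ 1) (φ 3) (φ 5) x (φ 4)
  have k22 := not_G8 h8 (φ 3) (φ 1) (φ 5) (φ 4) x (φ 0)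
  simp [ofEdges, hc, hx, hn] at k0 k1 k2 k3 k4 k5 k6 k7 k8 k9 k10 k11 k12 k13 k14 k15 k16 k17 k18 k19 k20 k21 k22
  simp only [Fin.forall_fin_succ]
  by_cases x0 : G.Adj x (φ 0) <;> by_cases x1 : G.Adj x (φ 1) <;>
  by_cases x2 : G.Adj x (φ 2) <;> by_cases x3 : G.Adj x (φ 3) <;>
  by_cases x4 : G.Adj x (φ 4) <;> by_cases x5 : G.Adj x (φ 5) <;>
  simp [x0, x1, x2, x3, x4, x5] at *

set_option linter.unusedSimpArgs false

section

variable {φ : G8 ↪g G} {x y : V}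

/-- Two vertices of this type would give `G5` if adjacent and a claw at `φ 0` if not. The other
types are handled in the same way. -/
lemma Attaches.eq_of_zero_four (h : SevenFree G) (hx : Attaches φ x {0, 4})
    (hy : Attaches φ y {0, 4}) : x = y := by
  by_contra hne
  by_cases hxy : G.Adj x y
  · have hyx := hxy.symm
    apply not_G5 h.g5 x (φ 0) (φ 4) (φ 2) y (φ 3) <;> simp [ofEdges, hx.ne, hx.ne', hx.adj, hx.adj', hy.ne, hy.ne', hy.adj, hy.adj', Ne.symm hne, *]
  · have hyx := mt Adj.symm hxy
    apply not_G1 h.g1 (φ 0) (φ 1) x y <;> simp [ofEdges, hx.ne, hx.ne', hx.adj, hx.adj', hy.ne, hy.ne', hy.adj, hy.adj', Ne.symm hne, *]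

lemma Attaches.eq_of_three_five (h : SevenFree G) (hx : Attaches φ x {3, 5})
    (hy : Attaches φ y {3, 5}) : x = y := by
  by_contra hne
  by_cases hxy : G.Adj x y
  · have hyx := hxy.symm
    apply not_G5 h.g5 x (φ 3) (φ 5) (φ 1) y (φ 0) <;> simp [ofEdges, hx.ne, hx.ne', hx.adj, hx.adj', hy.ne, hy.ne', hy.adj, hy.adj', Ne.symm hne, *]
  · have hyx := mt Adj.symm hxy
    apply not_G1 h.g1 (φ 3) (φ 1) x y <;> simp [ofEdges, hx.ne, hx.ne', hx.adj, hx.adj', hy.ne, hy.ne', hy.adj, hy.adj', Ne.symm hne, *]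

lemma Attaches.eq_of_zero_one_five (h : SevenFree G) (hx : Attaches φ x {0, 1, 5})
    (hy : Attaches φ y {0, 1, 5}) : x = y := by
  by_contra hne
  by_cases hxy : G.Adj x y
  · have hyx := hxy.symm
    apply not_G3 h.g3 (φ 0) (φ 1) x (φ 5) y <;> simp [ofEdges, hx.ne, hx.ne', hx.adj, hx.adj', hy.ne, hy.ne', hy.adj, hy.adj', Ne.symm hne, *]
  · have hyx := mt Adj.symm hxy
    apply not_G1 h.g1 (φ 0) (φ 2) x y <;> simp [ofEdges, hx.ne, hx.ne', hx.adj, hx.adj', hy.ne, hy.ne', hy.adj, hy.adj', Ne.symm hne, *]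

lemma Attaches.eq_of_two_three_four (h : SevenFree G) (hx : Attaches φ x {2, 3, 4})
    (hy : Attaches φ y {2, 3, 4}) : x = y := by
  by_contra hne
  by_cases hxy : G.Adj x y
  · have hyx := hxy.symm
    apply not_G3 h.g3 (φ 3) (φ 2) x (φ 4) y <;> simp [ofEdges, hx.ne, hx.ne', hx.adj, hx.adj', hy.ne, hy.ne', hy.adj, hy.adj', Ne.symm hne, *]
  · have hyx := mt Adj.symm hxy
    apply not_G1 h.g1 (φ 2) (φ 0) x y <;> simp [ofEdges, hx.ne, hx.ne', hx.adj, hx.adj', hy.ne, hy.ne', hy.adj, hy.adj', Ne.symm hne, *]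

lemma Attaches.not_adj_zero_four (h : SevenFree G) (hx : Attaches φ x ∅)
    (hy : Attaches φ y {0, 4}) : ¬ G.Adj x y := by
  intro hxy
  have hyx := hxy.symm
  have hne := hxy.ne
  apply not_G4 h.g4 (φ 2) (φ 0) (φ 4) y (φ 3) x <;> simp [ofEdges, hx.ne, hx.ne', hx.adj, hx.adj', hy.ne, hy.ne', hy.adj, hy.adj', Ne.symm hne, *]

lemma Attaches.not_adj_three_five (h : SevenFree G) (hx : Attaches φ x ∅)
    (hy : Attaches φ y {3, 5}) : ¬ G.Adj x y := by
  intro hxy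
  have hyx := hxy.symm
  have hne := hxy.ne
  apply not_G4 h.g4 (φ 1) (φ 3) (φ 5) y (φ 0) x <;> simp [ofEdges, hx.ne, hx.ne', hx.adj, hx.adj', hy.ne, hy.ne', hy.adj, hy.adj', Ne.symm hne, *]

lemma Attaches.not_adj_zero_one_five (h : SevenFree G) (hx : Attaches φ x ∅)
    (hy : Attaches φ y {0, 1, 5}) : ¬ G.Adj x y := by
  intro hxy
  have hyx := hxy.symm
  have hne := hxy.ne
  apply not_G1 h.g1 y (φ 0) (φ 5) x <;> simp [ofEdges, hx.ne, hx.ne', hx.adj, hx.adj', hy.ne, hy.ne', hy.adj, hy.adj', Ne.symm hne, *]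

lemma Attaches.not_adj_two_three_four (h : SevenFree G) (hx : Attaches φ x ∅)
    (hy : Attaches φ y {2, 3, 4}) : ¬ G.Adj x y := by
  intro hxy
  have hyx := hxy.symm
  have hne := hxy.ne
  apply not_G1 h.g1 y (φ 3) (φ 4) x <;> simp [ofEdges, hx.ne, hx.ne', hx.adj, hx.adj', hy.ne, hy.ne', hy.adj, hy.adj', Ne.symm hne, *]

lemma Attaches.not_zero_four_and_three_five (h : SevenFree G) (hx : Attaches φ x {0, 4})
    (hy : Attaches φ y {3, 5}) : False := by
  have hne : x ≠ y := by
    rintro rfl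
    have := fun i => (hx.adj i).symm.trans (hy.adj i)
    revert this; decide
  by_cases hxy : G.Adj x y
  · have hyx := hxy.symm
    apply not_G7 h.g7 (φ 0) (φ 1) (φ 2) (φ 3) x y <;> simp [ofEdges, hx.ne, hx.ne', hx.adj, hx.adj', hy.ne, hy.ne', hy.adj, hy.adj', Ne.symm hne, *]
  · have hyx := mt Adj.symm hxy
    apply not_G4 h.g4 (φ 0) (φ 1) (φ 2) (φ 3) x y <;> simp [ofEdges, hx.ne, hx.ne', hx.adj, hx.adj', hy.ne, hy.ne', hy.adj, hy.adj', Ne.symm hne, *]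

lemma Attaches.not_zero_four_and_two_three_four (h : SevenFree G) (hx : Attaches φ x {0, 4})
    (hy : Attaches φ y {2, 3, 4}) : False := by
  have hne : x ≠ y := by
    rintro rfl
    have := fun i => (hx.adj i).symm.trans (hy.adj i)
    revert this; decide
  by_cases hxy : G.Adj x y
  · have hyx := hxy.symm
    apply not_G7 h.g7 (φ 0) (φ 4) x y (φ 1) (φ 3) <;> simp [ofEdges, hx.ne, hx.ne', hx.adj, hx.adj', hy.ne, hy.ne', hy.adj, hy.adj', Ne.symm hne, *]
  · have hyx := mt Adj.symm hxy
    apply not_G4 h.g4 (φ 3) (φ 2) y (φ 4) (φ 5) x <;> simp [ofEdges, hx.ne, hx.ne', hx.adj, hx.adj', hy.ne, hy.ne', hy.adj, hy.adj', Ne.symm hne, *]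

lemma Attaches.not_three_five_and_zero_one_five (h : SevenFree G) (hx : Attaches φ x {3, 5})
    (hy : Attaches φ y {0, 1, 5}) : False := by
  have hne : x ≠ y := by
    rintro rfl
    have := fun i => (hx.adj i).symm.trans (hy.adj i)
    revert this; decide
  by_cases hxy : G.Adj x y
  · have hyx := hxy.symm
    apply not_G7 h.g7 (φ 3) (φ 5) x y (φ 2) (φ 0) <;> simp [ofEdges, hx.ne, hx.ne', hx.adj, hx.adj', hy.ne, hy.ne', hy.adj, hy.adj', Ne.symm hne, *]
  · have hyx := mt Adj.symm hxy
    apply not_G4 h.g4 (φ 0) (φ 1) y (φ 5) (φ 4) x <;> simp [ofEdges, hx.ne, hx.ne', hx.adj, hx.adj', hy.ne, hy.ne', hy.adj, hy.adj', Ne.symm hne, *]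

lemma Attaches.adj_zero_four_zero_one_five (h : SevenFree G) (hx : Attaches φ x {0, 4})
    (hy : Attaches φ y {0, 1, 5}) : G.Adj x y := by
  have hne : x ≠ y := by
    rintro rfl
    have := fun i => (hx.adj i).symm.trans (hy.adj i)
    revert this; decide
  by_contra hxy
  have hyx := mt Adj.symm hxy
  apply not_G1 h.g1 (φ 0) (φ 2) x y <;> simp [ofEdges, hx.ne, hx.ne', hx.adj, hx.adj', hy.ne, hy.ne', hy.adj, hy.adj', Ne.symm hne, *]

lemma Attaches.adj_three_five_two_three_four (h : SevenFree G) (hx : Attaches φ x {3, 5})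
    (hy : Attaches φ y {2, 3, 4}) : G.Adj x y := by
  have hne : x ≠ y := by
    rintro rfl
    have := fun i => (hx.adj i).symm.trans (hy.adj i)
    revert this; decide
  by_contra hxy
  have hyx := mt Adj.symm hxy
  apply not_G1 h.g1 (φ 3) (φ 1) x y <;> simp [ofEdges, hx.ne, hx.ne', hx.adj, hx.adj', hy.ne, hy.ne', hy.adj, hy.adj', Ne.symm hne, *]

lemma Attaches.not_adj_zero_one_five_two_three_four (h : SevenFree G) (hx : Attaches φ x {0, 1, 5})
    (hy : Attaches φ y {2, 3, 4}) : ¬ G.Adj x y := by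
  intro hxy
  have hyx := hxy.symm
  have hne := hxy.ne
  apply not_G1 h.g1 x (φ 0) (φ 5) y <;> simp [ofEdges, hx.ne, hx.ne', hx.adj, hx.adj', hy.ne, hy.ne', hy.adj, hy.adj', Ne.symm hne, *]

end

set_option linter.unusedSimpArgs true

/-! ### Connected graphs containing `G8` or `G9` -/

lemma nonempty_iso_of_G9 (hconn : G.Connected) (h : SevenFree G) (h8 : ¬ G8 ⊴ G) (φ : G9 ↪g G) :
    Nonempty (G ≃g G9) := by
  have hs : ∀ v, ∃ i, φ i = v := by
    refine forall_of_connected hconn (v := φ 0) ⟨0, rfl⟩ ?_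
    rintro _ ⟨i, rfl⟩ y hy
    by_contra hne
    push Not at hne
    exact not_adj_G9 h h8 φ (fun j => (hne j).symm) i hy.symm
  exact ⟨(RelIso.ofSurjective φ hs).symm⟩

section

variable {φ : G8 ↪g G} {x y : V}

lemma nonempty_iso_H1_left (hx : Attaches φ x {0, 4})
    (hs : ∀ v, v = x ∨ ∃ i, φ i = v) : Nonempty (G ≃g H1) := by
  refine nonempty_iso_of_tuple ![φ 0, φ 1, φ 2, φ 3, φ 4, φ 5, x] ?_ ?_
  · simp [Fin.forall_fin_succ, ofEdges, hx.ne', hx.adj']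
  · intro v
    rcases hs v with rfl | ⟨i, rfl⟩
    · exact ⟨6, rfl⟩
    · fin_cases i <;> simp [Fin.exists_fin_succ]

lemma nonempty_iso_H1_right (hx : Attaches φ x {3, 5})
    (hs : ∀ v, v = x ∨ ∃ i, φ i = v) : Nonempty (G ≃g H1) := by
  -- The symmetry of `G8` reversing its path exchanges `0` with `3`, `1` with `2` and `4` with `5`.
  refine nonempty_iso_of_tuple ![φ 3, φ 2, φ 1, φ 0, φ 5, φ 4, x] ?_ ?_
  · simp [Fin.forall_fin_succ, ofEdges, hx.ne', hx.adj']
  · intro v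
    rcases hs v with rfl | ⟨i, rfl⟩
    · exact ⟨6, rfl⟩
    · fin_cases i <;> simp [Fin.exists_fin_succ]

lemma nonempty_iso_H2_left (hx : Attaches φ x {0, 1, 5})
    (hs : ∀ v, v = x ∨ ∃ i, φ i = v) : Nonempty (G ≃g H2) := by
  refine nonempty_iso_of_tuple ![φ 0, φ 1, φ 2, φ 3, φ 4, φ 5, x] ?_ ?_
  · simp [Fin.forall_fin_succ, ofEdges, hx.ne', hx.adj']
  · intro v
    rcases hs v with rfl | ⟨i, rfl⟩
    · exact ⟨6, rfl⟩
    · fin_cases i <;> simp [Fin.exists_fin_succ]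

lemma nonempty_iso_H2_right (hx : Attaches φ x {2, 3, 4})
    (hs : ∀ v, v = x ∨ ∃ i, φ i = v) : Nonempty (G ≃g H2) := by
  refine nonempty_iso_of_tuple ![φ 3, φ 2, φ 1, φ 0, φ 5, φ 4, x] ?_ ?_
  · simp [Fin.forall_fin_succ, ofEdges, hx.ne', hx.adj']
  · intro v
    rcases hs v with rfl | ⟨i, rfl⟩
    · exact ⟨6, rfl⟩
    · fin_cases i <;> simp [Fin.exists_fin_succ]

lemma nonempty_iso_H3_left (hx : Attaches φ x {0, 4}) (hy : Attaches φ y {0, 1, 5})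
    (hxy : G.Adj x y) (hs : ∀ v, v = x ∨ v = y ∨ ∃ i, φ i = v) : Nonempty (G ≃g H3) := by
  refine nonempty_iso_of_tuple ![φ 0, φ 1, φ 2, φ 3, φ 4, φ 5, x, y] ?_ ?_
  · simp [Fin.forall_fin_succ, ofEdges, hx.ne', hx.adj', hy.ne', hy.adj', hxy, hxy.ne]
  · intro v
    rcases hs v with rfl | rfl | ⟨i, rfl⟩
    · exact ⟨6, rfl⟩
    · exact ⟨7, rfl⟩
    · fin_cases i <;> simp [Fin.exists_fin_succ]

lemma nonempty_iso_H3_right (hx : Attaches φ x {3, 5}) (hy : Attaches φ y {2, 3, 4})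
    (hxy : G.Adj x y) (hs : ∀ v, v = x ∨ v = y ∨ ∃ i, φ i = v) : Nonempty (G ≃g H3) := by
  refine nonempty_iso_of_tuple ![φ 3, φ 2, φ 1, φ 0, φ 5, φ 4, x, y] ?_ ?_
  · simp [Fin.forall_fin_succ, ofEdges, hx.ne', hx.adj', hy.ne', hy.adj', hxy, hxy.ne]
  · intro v
    rcases hs v with rfl | rfl | ⟨i, rfl⟩
    · exact ⟨6, rfl⟩
    · exact ⟨7, rfl⟩
    · fin_cases i <;> simp [Fin.exists_fin_succ]

lemma nonempty_iso_H3_middle (hx : Attaches φ x {0, 1, 5}) (hy : Attaches φ y {2, 3, 4})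
    (hxy : ¬ G.Adj x y) (hs : ∀ v, v = x ∨ v = y ∨ ∃ i, φ i = v) : Nonempty (G ≃g H3) := by
  have hyx : ¬ G.Adj y x := mt Adj.symm hxy
  -- The copy of `G8` inside `H3` is here a different one, the square of the path `x, φ 1, φ 0, φ 2,
  -- φ 4, y`; the two extra vertices are `φ 5` and `φ 3`.
  refine nonempty_iso_of_tuple ![φ 1, φ 2, φ 0, φ 4, x, y, φ 5, φ 3] ?_ ?_
  · have hne : x ≠ y := by
      rintro rfl
      have := fun i => (hx.adj i).symm.trans (hy.adj i)
      revert this; decide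
    simp [Fin.forall_fin_succ, ofEdges, hx.ne, hx.ne', hx.adj, hx.adj', hy.ne, hy.ne', hy.adj,
      hy.adj', hxy, hyx, hne]
  · intro v
    rcases hs v with rfl | rfl | ⟨i, rfl⟩
    · exact ⟨4, rfl⟩
    · exact ⟨5, rfl⟩
    · fin_cases i <;> simp [Fin.exists_fin_succ]

end

/-- A vertex missing the copy is not adjacent to any attached one, so by connectedness every outside
vertex is attached. Each type occurs at most once, and the only types that can coexist are `{0, 4}`
with `{0, 1, 5}`, its mirror image, and `{0, 1, 5}` with `{2, 3, 4}`; all three pairs yield `H3`. -/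
lemma nonempty_iso_of_G8 (hconn : G.Connected) (h : SevenFree G) (φ : G8 ↪g G) :
    Nonempty (G ≃g G8) ∨ Nonempty (G ≃g H1) ∨ Nonempty (G ≃g H2) ∨ Nonempty (G ≃g H3) := by
  have all : ∀ v, (∃ i, φ i = v) ∨ Attaches φ v {0, 4} ∨ Attaches φ v {3, 5} ∨
      Attaches φ v {0, 1, 5} ∨ Attaches φ v {2, 3, 4} := by
    refine forall_of_connected hconn (v := φ 0) (Or.inl ⟨0, rfl⟩) fun x hx y hxy => ?_
    by_cases hy : ∃ i, φ i = y
    · exact Or.inl hy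
    push Not at hy
    rcases attaches_G8 h φ fun i => (hy i).symm with hy' | hy'
    · exfalso
      rcases hx with ⟨i, rfl⟩ | hx | hx | hx | hx
      · simpa using (hy'.adj i).1 hxy.symm
      · exact hy'.not_adj_zero_four h hx hxy.symm
      · exact hy'.not_adj_three_five h hx hxy.symm
      · exact hy'.not_adj_zero_one_five h hx hxy.symm
      · exact hy'.not_adj_two_three_four h hx hxy.symm
    · exact Or.inr hy'
  by_cases ha : ∃ x, Attaches φ x {0, 4}
  · obtain ⟨x, hx⟩ := ha
    by_cases hb : ∃ y, Attaches φ y {0, 1, 5}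
    · obtain ⟨y, hy⟩ := hb
      refine Or.inr (Or.inr (Or.inr (nonempty_iso_H3_left hx hy (hx.adj_zero_four_zero_one_five h hy)
        fun v => ?_)))
      rcases all v with hv | hv | hv | hv | hv
      · exact Or.inr (Or.inr hv)
      · exact Or.inl (hv.eq_of_zero_four h hx)
      · exact (hx.not_zero_four_and_three_five h hv).elim
      · exact Or.inr (Or.inl (hv.eq_of_zero_one_five h hy))
      · exact (hx.not_zero_four_and_two_three_four h hv).elim
    · refine Or.inr (Or.inl (nonempty_iso_H1_left hx fun v => ?_))
      rcases all v with hv | hv | hv | hv | hv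
      · exact Or.inr hv
      · exact Or.inl (hv.eq_of_zero_four h hx)
      · exact (hx.not_zero_four_and_three_five h hv).elim
      · exact (hb ⟨v, hv⟩).elim
      · exact (hx.not_zero_four_and_two_three_four h hv).elim
  by_cases ha' : ∃ x, Attaches φ x {3, 5}
  · obtain ⟨x, hx⟩ := ha'
    by_cases hb : ∃ y, Attaches φ y {2, 3, 4}
    · obtain ⟨y, hy⟩ := hb
      refine Or.inr (Or.inr (Or.inr (nonempty_iso_H3_right hx hy
        (hx.adj_three_five_two_three_four h hy) fun v => ?_)))
      rcases all v with hv | hv | hv | hv | hv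
      · exact Or.inr (Or.inr hv)
      · exact (ha ⟨v, hv⟩).elim
      · exact Or.inl (hv.eq_of_three_five h hx)
      · exact (hx.not_three_five_and_zero_one_five h hv).elim
      · exact Or.inr (Or.inl (hv.eq_of_two_three_four h hy))
    · refine Or.inr (Or.inl (nonempty_iso_H1_right hx fun v => ?_))
      rcases all v with hv | hv | hv | hv | hv
      · exact Or.inr hv
      · exact (ha ⟨v, hv⟩).elim
      · exact Or.inl (hv.eq_of_three_five h hx)
      · exact (hx.not_three_five_and_zero_one_five h hv).elim
      · exact (hb ⟨v, hv⟩).elim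
  by_cases hb : ∃ x, Attaches φ x {0, 1, 5}
  · obtain ⟨x, hx⟩ := hb
    by_cases hb' : ∃ y, Attaches φ y {2, 3, 4}
    · obtain ⟨y, hy⟩ := hb'
      refine Or.inr (Or.inr (Or.inr (nonempty_iso_H3_middle hx hy
        (hx.not_adj_zero_one_five_two_three_four h hy) fun v => ?_)))
      rcases all v with hv | hv | hv | hv | hv
      · exact Or.inr (Or.inr hv)
      · exact (ha ⟨v, hv⟩).elim
      · exact (ha' ⟨v, hv⟩).elim
      · exact Or.inl (hv.eq_of_zero_one_five h hx)
      · exact Or.inr (Or.inl (hv.eq_of_two_three_four h hy))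
    · refine Or.inr (Or.inr (Or.inl (nonempty_iso_H2_left hx fun v => ?_)))
      rcases all v with hv | hv | hv | hv | hv
      · exact Or.inr hv
      · exact (ha ⟨v, hv⟩).elim
      · exact (ha' ⟨v, hv⟩).elim
      · exact Or.inl (hv.eq_of_zero_one_five h hx)
      · exact (hb' ⟨v, hv⟩).elim
  by_cases hb' : ∃ x, Attaches φ x {2, 3, 4}
  · obtain ⟨x, hx⟩ := hb'
    refine Or.inr (Or.inr (Or.inl (nonempty_iso_H2_right hx fun v => ?_)))
    rcases all v with hv | hv | hv | hv | hv
    · exact Or.inr hv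
    · exact (ha ⟨v, hv⟩).elim
    · exact (ha' ⟨v, hv⟩).elim
    · exact (hb ⟨v, hv⟩).elim
    · exact Or.inl (hv.eq_of_two_three_four h hx)
  refine Or.inl ⟨(RelIso.ofSurjective φ fun v => ?_).symm⟩
  rcases all v with hv | hv | hv | hv | hv
  · exact hv
  · exact (ha ⟨v, hv⟩).elim
  · exact (ha' ⟨v, hv⟩).elim
  · exact (hb ⟨v, hv⟩).elim
  · exact (hb' ⟨v, hv⟩).elim

/-! ### Obstructions in the root -/

/-- The line graph of a spanning subgraph of an induced subgraph of `K` is an induced subgraph of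
`L(K)`. -/
lemma isIndContained_lineGraph_of_le {n : ℕ} {S T : SimpleGraph (Fin n)} (hST : S ≤ T)
    {W : Type*} {K : SimpleGraph W} (h : T ⊴ K) : S.lineGraph ⊴ K.lineGraph :=
  ((IsContained.of_le hST).trans h.isContained).isIndContained_lineGraph

/-- An edge that meets exactly two of the edges `xp`, `xq`, `xr` is `pq`. -/
lemma adj_of_meets_two {W : Type*} {K : SimpleGraph W} {x p q r : W} (hpq : p ≠ q)
    (hp : K.Adj x p) (hq : K.Adj x q) (hr : K.Adj x r) {d : K.edgeSet}
    (dp : K.lineGraph.Adj d ⟨s(x, p), hp⟩) (dq : K.lineGraph.Adj d ⟨s(x, q), hq⟩)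
    (dr : ¬ K.lineGraph.Adj d ⟨s(x, r), hr⟩) (nr : d ≠ ⟨s(x, r), hr⟩) : K.Adj p q := by
  have hx : x ∉ (d : Sym2 W) := fun hx =>
    dr (lineGraph_adj_iff_exists.2 ⟨nr, x, hx, Sym2.mem_mk_left _ _⟩)
  have meets : ∀ {y : W} (hy : K.Adj x y), K.lineGraph.Adj d ⟨s(x, y), hy⟩ →
      y ∈ (d : Sym2 W) := by
    intro y hy h
    obtain ⟨-, w, hw, hw'⟩ := lineGraph_adj_iff_exists.1 h
    rcases Sym2.mem_iff.1 hw' with rfl | rfl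
    · exact absurd hw hx
    · exact hw
  have hd := d.2
  rwa [(Sym2.mem_and_mem_iff hpq).1 ⟨meets hp dp, meets hq dq⟩] at hd

lemma exists_adj_two_of_K4e : ∀ i j k : Fin 4, K4e.Adj i j → K4e.Adj j k → K4e.Adj i k →
    ∃ l, K4e.Adj l i ∧ K4e.Adj l j ∧ ¬ K4e.Adj l k ∧ l ≠ k ∨
      K4e.Adj l i ∧ K4e.Adj l k ∧ ¬ K4e.Adj l j ∧ l ≠ j ∨
      K4e.Adj l j ∧ K4e.Adj l k ∧ ¬ K4e.Adj l i ∧ l ≠ i := by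
  decide

/-- If every triangle of `L(K)` lies in an induced `K₄ - e`, then `K` is claw-free. -/
lemma not_G1_of_lineGraph {W : Type*} {K : SimpleGraph W}
    (htri : ∀ a b c : K.edgeSet, K.lineGraph.Adj a b → K.lineGraph.Adj b c →
      K.lineGraph.Adj a c → ∃ f : K4e ↪g K.lineGraph,
        a ∈ Set.range f ∧ b ∈ Set.range f ∧ c ∈ Set.range f) : ¬ G1 ⊴ K := by
  rintro ⟨φ⟩
  have hφ : ∀ i, i ≠ 0 → K.Adj (φ 0) (φ i) := fun i hi =>
    φ.map_adj_iff.2 (by revert i; decide)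
  have hne : ∀ i j, i ≠ j → φ i ≠ φ j := fun i j => φ.injective.ne
  have hn : ∀ i j, i ≠ 0 → j ≠ 0 → ¬ K.Adj (φ i) (φ j) := fun i j hi hj h =>
    absurd (φ.map_adj_iff.1 h) (by clear h; revert i j; decide)
  let e : ∀ i : Fin 4, i ≠ 0 → K.edgeSet := fun i hi => ⟨s(φ 0, φ i), hφ i hi⟩
  have he : ∀ i j hi hj, i ≠ j → K.lineGraph.Adj (e i hi) (e j hj) := fun i j hi hj hij => by
    refine lineGraph_adj_iff_exists.2 ⟨fun h => hij ?_, φ 0, by simp [e], by simp [e]⟩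
    exact φ.injective (Sym2.congr_right.1 (congrArg Subtype.val h))
  have n1 : (1 : Fin 4) ≠ 0 := by decide
  have n2 : (2 : Fin 4) ≠ 0 := by decide
  have n3 : (3 : Fin 4) ≠ 0 := by decide
  have h12 := he 1 2 n1 n2 (by decide)
  have h23 := he 2 3 n2 n3 (by decide)
  have h13 := he 1 3 n1 n3 (by decide)
  obtain ⟨f, ⟨i, hi⟩, ⟨j, hj⟩, ⟨k, hk⟩⟩ := htri _ _ _ h12 h23 h13
  rw [← hi, ← hj, f.map_adj_iff] at h12
  rw [← hj, ← hk, f.map_adj_iff] at h23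
  rw [← hi, ← hk, f.map_adj_iff] at h13
  -- The fourth vertex `f l` is an edge of `K` meeting exactly two of the three edges of the claw,
  -- so it joins two leaves.
  obtain ⟨l, hl⟩ := exists_adj_two_of_K4e i j k h12 h23 h13
  simp only [← f.map_adj_iff, ← f.injective.ne_iff, hi, hj, hk] at hl
  rcases hl with ⟨h1, h2, h3, h4⟩ | ⟨h1, h2, h3, h4⟩ | ⟨h1, h2, h3, h4⟩
  · exact hn 1 2 n1 n2 (adj_of_meets_two (hne 1 2 (by decide)) _ _ _ h1 h2 h3 h4)
  · exact hn 1 3 n1 n3 (adj_of_meets_two (hne 1 3 (by decide)) _ _ _ h1 h2 h3 h4)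
  · exact hn 2 3 n2 n3 (adj_of_meets_two (hne 2 3 (by decide)) _ _ _ h1 h2 h3 h4)

end ForbiddenGraphs

open ForbiddenGraphs in
theorem mainTheorem2 {V : Type*} [Finite V] (G : SimpleGraph V) (hconn : G.Connected)
    (hK3 : ¬ Nonempty (G ≃g (⊤ : SimpleGraph (Fin 3))))
    (hG8 : ¬ Nonempty (G ≃g ForbiddenGraphs.G8))
    (hG9 : ¬ Nonempty (G ≃g ForbiddenGraphs.G9))
    (hH1 : ¬ Nonempty (G ≃g ForbiddenGraphs.H1))
    (hH2 : ¬ Nonempty (G ≃g ForbiddenGraphs.H2))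
    (hH3 : ¬ Nonempty (G ≃g ForbiddenGraphs.H3))
    (htri : ∀ a b c : V, G.Adj a b → G.Adj b c → G.Adj a c →
      ∃ f : ForbiddenGraphs.K4e ↪g G,
        a ∈ Set.range f ∧ b ∈ Set.range f ∧ c ∈ Set.range f)
    (hG1 : ¬ ForbiddenGraphs.G1.IsIndContained G)
    (hG2 : ¬ ForbiddenGraphs.G2.IsIndContained G)
    (hG3 : ¬ ForbiddenGraphs.G3.IsIndContained G)
    (hG4 : ¬ ForbiddenGraphs.G4.IsIndContained G)
    (hG5 : ¬ ForbiddenGraphs.G5.IsIndContained G)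
    (hG6 : ¬ ForbiddenGraphs.G6.IsIndContained G)
    (hG7 : ¬ ForbiddenGraphs.G7.IsIndContained G)
    (hF1 : ¬ ForbiddenGraphs.F1.IsIndContained G)
    (hF2 : ¬ ForbiddenGraphs.F2.IsIndContained G) :
    ∃ (n : ℕ) (H : SimpleGraph (Fin n)),
      H.Connected ∧ Nonempty (G ≃g H.lineGraph.lineGraph) := by
  have h : SevenFree G := ⟨hG1, hG2, hG3, hG4, hG5, hG6, hG7⟩
  have h8 : ¬ G8.IsIndContained G := by
    rintro ⟨φ⟩
    rcases nonempty_iso_of_G8 hconn h φ with h' | h' | h' | h'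
    exacts [hG8 h', hH1 h', hH2 h', hH3 h']
  have h9 : ¬ G9.IsIndContained G := fun ⟨φ⟩ => hG9 (nonempty_iso_of_G9 hconn h h8 φ)
  obtain ⟨m, K, hK, ⟨ψ⟩⟩ := exists_root hconn h h8 h9
  have tr : ∀ {U : Type} {F : SimpleGraph U}, ¬ F.IsIndContained G →
      ¬ F.IsIndContained K.lineGraph := fun hF hF' => hF (hF'.trans ⟨ψ.symm.toEmbedding⟩)
  -- The labellings are chosen so that `G5`, …, `G9` contain `G4`, and `G3` contains `G2`, on the
  -- same vertices. A copy of such a graph in `K` is thus a possibly non-induced copy of `G4` or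
  -- `G2`, which suffices for an induced `F1` or `F2` in `L(K)`.
  have b1 : ∀ T : SimpleGraph (Fin 6), (∀ a b, G4.Adj a b → T.Adj a b) → ¬ T.IsIndContained K := fun T hT hK =>
    tr hF1 (isIndContained_lineGraph_of_le (fun _ _ => hT _ _) hK)
  have b2 : ∀ T : SimpleGraph (Fin 5), (∀ a b, G2.Adj a b → T.Adj a b) → ¬ T.IsIndContained K := fun T hT hK =>
    tr hF2 (isIndContained_lineGraph_of_le (fun _ _ => hT _ _) hK)
  have hK1 : ¬ G1.IsIndContained K := by
    refine not_G1_of_lineGraph fun a b c hab hbc hac => ?_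
    obtain ⟨f, ⟨i, hi⟩, ⟨j, hj⟩, ⟨k, hk⟩⟩ := htri (ψ.symm a) (ψ.symm b) (ψ.symm c)
      (ψ.symm.map_adj_iff.2 hab) (ψ.symm.map_adj_iff.2 hbc) (ψ.symm.map_adj_iff.2 hac)
    exact ⟨f.trans ψ.toEmbedding, ⟨i, by simp [hi]⟩, ⟨j, by simp [hj]⟩, ⟨k, by simp [hk]⟩⟩
  obtain ⟨n, H, hH, ⟨χ⟩⟩ := exists_root hK
    ⟨hK1, b2 _ (fun _ _ => id), b2 _ (by decide), b1 _ (fun _ _ => id), b1 _ (by decide), b1 _ (by decide),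
      b1 _ (by decide)⟩ (b1 _ (by decide)) (b1 _ (by decide))
  exact ⟨n, H, hH, ⟨ψ.trans χ.lineGraph⟩⟩
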